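/- **Setting.** Let $X,Y,Z$ be real Riesz spaces, $Z$ Dedekind complete and weakly $\sigma$-distributive. A *$(D)$-sequence* in $Z$ is a bounded double sequence $(a_{ij})$ with $a_{ij}\downarrow 0$ as $j\to\infty$ for every $i$; weak $\sigma$-distributivity means $\bigwedge_{\varphi\in\mathbb N^{\mathbb N}}\bigvee_i a_{i\varphi(i)}=0$ for every $(D)$-sequence. A net $(z_\iota)$ in $Z$ is *$(D)$-convergent* to $z$ if there is a $(D)$-sequence $(a_{ij})$ such that for every $\varphi\in\mathbb N^{\mathbb N}$ one has $|z_\iota-z|\le\bigvee_i a_{i\varphi(i)}$ for all sufficiently large $\iota$. A net *order-converges* to $z$ if there are an increasing net with supremum $z$ and a decreasing net with infimum $z$ such that the given net eventually lies between any member of the first and any member of the second. Let $X$ and $Y$ carry Hausdorff Boccuto–Candeloro net convergence structures $\eta_1,\eta_2$. These are convergences of nets with unique limits such that: if $x_i\to x$ and $y_j\to y$, then $x_i+y_j\to x+y$ along the product index set; if $x_i\to x$, $y_i\to y$ and $x_i\le y_i$ for cofinally many $i$, then $x\le y$; if $x_i\to x$ then $|x_i|\to|x|$; if $x_i\to x$,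 $y_i\to x$ and eventually $x_i\le z_i\le y_i$, then $z_i\to x$; if a sequence $(x_n)$ converges then $\frac1n x_n\to0$; constant nets converge to their value; if $x_i\to x$, so does every quasi-subnet $(y_j)$, i.e. every net such that each tail of $(x_i)$ contains, as a set, a tail of $(y_j)$; if $x_i\to x$, $y_i\to x$ and $z_i\in\{x_i,y_i\}$ for all $i$, then $z_i\to x$. Assume that in $(X,\eta_1)$ every sequence $u_n\downarrow0$ converges to $0$. Let $X\times Y\to Z$, $(x,y)\mapsto xy$, be bilinear, isotone on $X^+\times Y^+$, with each partial map $x\mapsto xy$ and $y\mapsto xy$ continuous from $\eta_1$, resp. $\eta_2$, to $(D)$-convergence in $Z$. Let $\mathcal H$ be a family of subsets of $\Omega$ with $\emptyset,\Omega\in\mathcal H$ such that for every $A\in\mathcal H$ the set $\mathcal P(A)$ of countable partitions of $A$ into non-empty members of $\mathcal H$ is directed by refinement (for example, an algebra of sets). Let $\mu:\mathcal H\to Y^+$ be $\sigma$-additive: for pairwise disjoint $A_n\in\mathcal H$ with $\bigcup_nA_n\in\mathcal H$, the net $\sum_{j\in J}\mu(A_j)$, $J\subset\mathbb N$ finite,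 $\eta_2$-converges to $\mu(\bigcup_nA_n)$. A function $f:\Omega\to X$ is *$S^*$-partition integrable* on $A\in\mathcal H$ with integral $\int_A^{S^*}f\,d\mu=s\in Z$ if for every choice function $\delta$ (assigning to each non-empty $\alpha\subseteq\Omega$ a point $\delta_\alpha\in\alpha$) the series $\sum_{\alpha\in P}f(\delta_\alpha)\mu(\alpha)$ exists, as the order limit of its finite partial sums, for all $P\in\mathcal P(A)$ refining some fixed partition, and these sums $(D)$-converge to $s$ along $\mathcal P(A)$. **Theorem.** Let $f_n:\Omega\to X$ ($n\in\mathbb N$) be non-negative and $S^*$-partition integrable on $\Omega$, and let $f:\Omega\to X$ be non-negative. Suppose that there are $N\in\mathcal H$ with $\mu(N)=0$ and $\Omega\setminus N\in\mathcal H$, and a sequence $u_n\downarrow0$ in $X$, such that $|f_n(\omega)-f(\omega)|\le u_n$ for all $n$ and all $\omega\in\Omega\setminus N$. Then $f$ is $S^*$-partition integrable on $\Omega\setminus N$ and on $\Omega$, with $$\int_{\Omega\setminus N}^{S^*}f\,d\mu=\int_\Omega^{S^*}f\,d\mu ,$$ and $\int_\Omega^{S^*}f_n\,d\mu$ order-converges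 in $Z$ to $\int_\Omega^{S^*}f\,d\mu$. -/

import Mathlib

open Set

/-! ### Nets, order convergence, `(D)`-convergence

A real Riesz space is given by the instances `[AddCommGroup X] [Lattice X] [IsOrderedAddMonoid X]
[Module ℝ X] [PosSMulMono ℝ X]`; it is Dedekind complete when its lattice structure is a
`ConditionallyCompleteLattice`. -/

/-- Order convergence (`(o₃)`-convergence) of a net: the net is eventually squeezed between every
member of an increasing net with supremum `l` and every member of a decreasing net with infimum
`l`. Only the values of the two auxiliary nets matter, so they are given by their (nonempty,
upwards resp. downwards directed) ranges `L` and `U`. -/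
def OrderConvergesTo {I X : Type*} [Preorder I] [Preorder X] (x : I → X) (l : X) : Prop :=
  ∃ L U : Set X, L.Nonempty ∧ U.Nonempty ∧ DirectedOn (· ≤ ·) L ∧ DirectedOn (· ≥ ·) U ∧
    IsLUB L l ∧ IsGLB U l ∧
    ∀ a ∈ L, ∀ b ∈ U, ∃ i₀ : I, ∀ i, i₀ ≤ i → a ≤ x i ∧ x i ≤ b

/-- A `(D)`-sequence (regulator): a bounded double sequence with `a i j ↓ 0` as `j → ∞`, for
every `i`. -/
structure IsDSequence {Z : Type*} [Preorder Z] [Zero Z] (a : ℕ → ℕ → Z) : Prop where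
  bddAbove : BddAbove (range fun p : ℕ × ℕ => a p.1 p.2)
  antitone : ∀ i, Antitone (a i)
  isGLB : ∀ i, IsGLB (range (a i)) 0

/-- Weak `σ`-distributivity of a Dedekind complete Riesz space. -/
def WeaklySigmaDistributive (Z : Type*) [ConditionallyCompleteLattice Z] [Zero Z] : Prop :=
  ∀ a : ℕ → ℕ → Z, IsDSequence a → IsGLB (range fun φ : ℕ → ℕ => ⨆ i, a i (φ i)) 0

/-- `(D)`-convergence of a net in a Dedekind complete Riesz space. -/
def DConvergesTo {I Z : Type*} [Preorder I] [ConditionallyCompleteLattice Z] [AddCommGroup Z]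
    (x : I → Z) (l : Z) : Prop :=
  ∃ a : ℕ → ℕ → Z, IsDSequence a ∧
    ∀ φ : ℕ → ℕ, ∃ i₀ : I, ∀ i, i₀ ≤ i → |x i - l| ≤ ⨆ k, a k (φ k)

/-! ### Net convergence structures -/

/-- A relation "the net `x` converges to `l`" on the nets of `X` (indexed by nonempty directed
sets). -/
def NetConvergence (X : Type*) : Type _ :=
  ∀ (I : Type) [Preorder I] [IsDirectedOrder I] [Nonempty I], (I → X) → X → Prop

/-- The product of two directed sets is directed. -/
instance isDirectedOrder_prod {I J : Type*} [Preorder I] [IsDirectedOrder I]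
    [Preorder J] [IsDirectedOrder J] : IsDirectedOrder (I × J) :=
  ⟨fun p q =>
    let ⟨i, hpi, hqi⟩ := exists_ge_ge p.1 q.1
    let ⟨j, hpj, hqj⟩ := exists_ge_ge p.2 q.2
    ⟨(i, j), ⟨hpi, hpj⟩, ⟨hqi, hqj⟩⟩⟩

/-- `y` is a quasi-subnet of `x`: every tail of `x` contains (as a set) a tail of `y`. -/
def IsQuasiSubnet {I J X : Type*} [Preorder I] [Preorder J] (y : J → X) (x : I → X) : Prop :=
  ∀ i₀ : I, ∃ j₀ : J, y '' Ici j₀ ⊆ x '' Ici i₀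

/-- Hausdorff Boccuto–Candeloro net convergence structures on a Riesz space. -/
structure IsBoccutoCandeloro {X : Type*} [AddCommGroup X] [Lattice X] [Module ℝ X]
    (η : NetConvergence X) : Prop where
  add : ∀ (I J : Type) [Preorder I] [IsDirectedOrder I] [Nonempty I]
    [Preorder J] [IsDirectedOrder J] [Nonempty J] (x : I → X) (y : J → X) (a b : X),
    η I x a → η J y b → η (I × J) (fun p => x p.1 + y p.2) (a + b)
  le : ∀ (I : Type) [Preorder I] [IsDirectedOrder I] [Nonempty I] (x y : I → X) (a b : X),
    η I x a → η I y b → (∀ i, ∃ j, i ≤ j ∧ x j ≤ y j) → a ≤ b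
  abs : ∀ (I : Type) [Preorder I] [IsDirectedOrder I] [Nonempty I] (x : I → X) (a : X),
    η I x a → η I (fun i => |x i|) |a|
  squeeze : ∀ (I : Type) [Preorder I] [IsDirectedOrder I] [Nonempty I] (x y z : I → X) (a : X),
    η I x a → η I y a → (∃ i₀, ∀ i, i₀ ≤ i → x i ≤ z i ∧ z i ≤ y i) → η I z a
  inv_smul : ∀ (x : ℕ → X) (a : X),
    η ℕ x a → η ℕ (fun n => ((n : ℝ) + 1)⁻¹ • x n) 0
  const : ∀ (I : Type) [Preorder I] [IsDirectedOrder I] [Nonempty I] (a : X),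
    η I (fun _ => a) a
  quasiSubnet : ∀ (I J : Type) [Preorder I] [IsDirectedOrder I] [Nonempty I]
    [Preorder J] [IsDirectedOrder J] [Nonempty J] (x : I → X) (y : J → X) (a : X),
    η I x a → IsQuasiSubnet y x → η J y a
  mix : ∀ (I : Type) [Preorder I] [IsDirectedOrder I] [Nonempty I] (x y z : I → X) (a : X),
    η I x a → η I y a → (∀ i, z i = x i ∨ z i = y i) → η I z a
  hausdorff : ∀ (I : Type) [Preorder I] [IsDirectedOrder I] [Nonempty I] (x : I → X) (a b : X),
    η I x a → η I x b → a = b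

/-- `(D)`-convergence as a relation on nets. -/
def dNetConvergence (Z : Type*) [ConditionallyCompleteLattice Z] [AddCommGroup Z] :
    NetConvergence Z :=
  fun _ _ _ _ x l => DConvergesTo x l

/-- The monotone convergence property for sequences: a sequence decreasing to `0` converges
to `0`. -/
def HasSeqMonotoneConvergence {X : Type*} [Preorder X] [Zero X] (η : NetConvergence X) : Prop :=
  ∀ u : ℕ → X, Antitone u → IsGLB (range u) 0 → η ℕ u 0

/-- Continuity of a map for two convergences. -/
def IsNetContinuous {X Z : Type*} (η : NetConvergence X) (ζ : NetConvergence Z) (g : X → Z) :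
    Prop :=
  ∀ (I : Type) [Preorder I] [IsDirectedOrder I] [Nonempty I] (x : I → X) (a : X),
    η I x a → ζ I (fun i => g (x i)) (g a)

/-- A product `X × Y → Z`: a bilinear map, isotone on the positive cones, all of whose partial
maps are continuous. -/
structure IsRieszProduct {X Y Z : Type*}
    [AddCommGroup X] [Lattice X] [Module ℝ X] [AddCommGroup Y] [Lattice Y] [Module ℝ Y]
    [AddCommGroup Z] [Lattice Z] [Module ℝ Z]
    (η₁ : NetConvergence X) (η₂ : NetConvergence Y) (η₃ : NetConvergence Z)
    (B : X →ₗ[ℝ] Y →ₗ[ℝ] Z) : Prop where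
  isotone : ∀ x x' y y', 0 ≤ x → x ≤ x' → 0 ≤ y → y ≤ y' → B x y ≤ B x' y'
  continuous_left : ∀ y, IsNetContinuous η₁ η₃ fun x => B x y
  continuous_right : ∀ x, IsNetContinuous η₂ η₃ fun y => B x y

/-- `σ`-additivity of a set function on a family `H` of sets, with respect to the convergence
`η`; the series is the unconditional one. Only the values of `μ` on `H` matter. -/
def IsSigmaAdditive {Ω Y : Type*} [AddCommGroup Y] (η : NetConvergence Y)
    (H : Set (Set Ω)) (μ : Set Ω → Y) : Prop :=
  ∀ A : ℕ → Set Ω, (∀ n, A n ∈ H) → Pairwise (fun m n => Disjoint (A m) (A n)) →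
    (⋃ n, A n) ∈ H → η (Finset ℕ) (fun J => ∑ j ∈ J, μ (A j)) (μ (⋃ n, A n))

/-! ### The `S*`-partition integral -/

/-- A countable (possibly finite) partition of `A` into nonempty members of `H`. -/
structure CountablePartition {Ω : Type*} (H : Set (Set Ω)) (A : Set Ω) where
  parts : Set (Set Ω)
  countable : parts.Countable
  mem : ∀ α ∈ parts, α ∈ H
  nonempty : ∀ α ∈ parts, α.Nonempty
  disjoint : parts.PairwiseDisjoint id
  sUnion_eq : ⋃₀ parts = A

/-- The refinement order: `P ≤ Q` when `Q` refines `P`. -/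
instance CountablePartition.instPreorder {Ω : Type*} (H : Set (Set Ω)) (A : Set Ω) :
    Preorder (CountablePartition H A) where
  le P Q := ∀ β ∈ Q.parts, ∃ α ∈ P.parts, β ⊆ α
  le_refl _ β hβ := ⟨β, hβ, subset_rfl⟩
  le_trans _ _ _ h₁ h₂ γ hγ :=
    let ⟨β, hβ, hγβ⟩ := h₂ γ hγ
    let ⟨α, hα, hβα⟩ := h₁ β hβ
    ⟨α, hα, hγβ.trans hβα⟩

/-- A choice function picks a point of every nonempty subset of `Ω`. -/
def IsChoiceFunction {Ω : Type*} (δ : {α : Set Ω // α.Nonempty} → Ω) : Prop :=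
  ∀ α, δ α ∈ α.1

/-- The finite partial sum `∑_{α ∈ J} f(δ_α) μ(α)` over a finite set `J` of blocks of `P`. -/
def partialRiemannSum {Ω X Y Z : Type*} [AddCommGroup X] [Module ℝ X] [AddCommGroup Y]
    [Module ℝ Y] [AddCommGroup Z] [Module ℝ Z] (B : X →ₗ[ℝ] Y →ₗ[ℝ] Z)
    (f : Ω → X) (μ : Set Ω → Y) (δ : {α : Set Ω // α.Nonempty} → Ω)
    {H : Set (Set Ω)} {A : Set Ω} (P : CountablePartition H A) (J : Finset P.parts) : Z :=
  ∑ α ∈ J, B (f (δ ⟨α.1, P.nonempty α.1 α.2⟩)) (μ α.1)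

/-- The series `∑_{α ∈ P} f(δ_α) μ(α)` exists, as an unconditional order limit, and equals `t`. -/
def HasRiemannSeries {Ω X Y Z : Type*} [AddCommGroup X] [Module ℝ X] [AddCommGroup Y]
    [Module ℝ Y] [AddCommGroup Z] [Preorder Z] [Module ℝ Z] (B : X →ₗ[ℝ] Y →ₗ[ℝ] Z)
    (f : Ω → X) (μ : Set Ω → Y) (δ : {α : Set Ω // α.Nonempty} → Ω)
    {H : Set (Set Ω)} {A : Set Ω} (P : CountablePartition H A) (t : Z) : Prop :=
  OrderConvergesTo (partialRiemannSum B f μ δ P) t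

/-- `f` is `S*`-partition integrable on `A` with integral `s`: for every choice function `δ`, the
series `S P = ∑_{α ∈ P} f(δ_α) μ(α)` exists for all partitions `P` of `A` refining a suitable one,
and `S` is `(D)`-convergent to `s` along the partitions of `A` ordered by refinement. (The
values of `S` at the remaining partitions have no influence on its limit.) -/
def HasSStarIntegral {Ω X Y Z : Type*} [AddCommGroup X] [Module ℝ X] [AddCommGroup Y]
    [Module ℝ Y] [ConditionallyCompleteLattice Z] [AddCommGroup Z] [Module ℝ Z]
    (B : X →ₗ[ℝ] Y →ₗ[ℝ] Z) (H : Set (Set Ω)) (f : Ω → X) (μ : Set Ω → Y) (A : Set Ω) (s : Z) :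
    Prop :=
  ∀ δ : {α : Set Ω // α.Nonempty} → Ω, IsChoiceFunction δ →
    ∃ S : CountablePartition H A → Z,
      (∃ P₀, ∀ P, P₀ ≤ P → HasRiemannSeries B f μ δ P (S P)) ∧ DConvergesTo S s

/-- Order uniform convergence of `f n` to `g` on the set `E`. -/
def OrderUniformlyConvergesOn {Ω X : Type*} [AddCommGroup X] [Lattice X]
    (f : ℕ → Ω → X) (g : Ω → X) (E : Set Ω) : Prop :=
  ∃ u : ℕ → X, Antitone u ∧ IsGLB (range u) 0 ∧ ∀ n, ∀ ω ∈ E, |f n ω - g ω| ≤ u n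

/-! Put `b n = B (u n) (μ univ)`. It decreases, and it (D)-converges to 0 by monotone convergence in
X and continuity of the product. Once a partition separates N from its complement, blocks inside N
are null and on all others `f n` and `g` differ by at most `u n`. Finite sums of μ over blocks stay
below `μ univ` (`IsSigmaAdditive.sum_parts_le`), so the Riemann series of `f n` and `g` differ by at
most `b n`. All terms being non-negative, a series is the supremum of its partial sums, so this
bound also makes the series of `g` exist.

Passing to limits, which weak σ-distributivity permits (`DConvergesTo.le_add`), gives `|s m - s n| ≤
b n + b m`; Dedekind completeness then yields t with `|s n - t| ≤ b n`. For t to be the integral of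
`g`, one regulator must replace the countably many regulators of the `f n`: they are truncated at a
common bound and merged (`DConvergesTo.of_uniform_approx`).

Removing N changes no series along fine partitions, because the blocks inside N contribute 0. -/

/-! ### Regulators -/

section Regulators

variable {Z : Type*} [AddCommGroup Z] [ConditionallyCompleteLattice Z]

theorem IsDSequence.nonneg {a : ℕ → ℕ → Z} (ha : IsDSequence a) (i j : ℕ) : 0 ≤ a i j :=
  (ha.isGLB i).1 ⟨j, rfl⟩

theorem IsDSequence.bddAbove_range {a : ℕ → ℕ → Z} (ha : IsDSequence a) (φ : ℕ → ℕ) :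
    BddAbove (range fun k => a k (φ k)) := by
  obtain ⟨M, hM⟩ := ha.bddAbove
  exact ⟨M, by rintro _ ⟨k, rfl⟩; exact hM ⟨(k, φ k), rfl⟩⟩

theorem IsDSequence.iSup_le_iSup_zero {a : ℕ → ℕ → Z} (ha : IsDSequence a) (φ : ℕ → ℕ) :
    ⨆ k, a k (φ k) ≤ ⨆ k, a k 0 :=
  ciSup_le fun k => (ha.antitone k (Nat.zero_le _)).trans
    (le_ciSup (ha.bddAbove_range fun _ => 0) k)

theorem IsDSequence.iSup_nonneg {a : ℕ → ℕ → Z} (ha : IsDSequence a) (φ : ℕ → ℕ) :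
    0 ≤ ⨆ k, a k (φ k) :=
  (ha.nonneg 0 _).trans (le_ciSup (ha.bddAbove_range φ) 0)

/-- A sequence of regulators, truncated at `u` and merged into one regulator. -/
theorem isDSequence_merge {a : ℕ → ℕ → ℕ → Z} (ha : ∀ n, IsDSequence (a n)) {u : Z}
    (hu : 0 ≤ u) : IsDSequence fun k j => a k.unpair.1 k.unpair.2 j ⊓ u where
  bddAbove := ⟨u, by rintro _ ⟨p, rfl⟩; exact inf_le_right⟩
  antitone k _ _ h := inf_le_inf_right _ ((ha _).antitone _ h)
  isGLB k := by
    refine ⟨?_, fun c hc => ((ha k.unpair.1).isGLB k.unpair.2).2 ?_⟩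
    · rintro _ ⟨j, rfl⟩
      exact le_inf ((ha _).nonneg _ _) hu
    · rintro _ ⟨j, rfl⟩
      exact (hc ⟨j, rfl⟩).trans inf_le_left

theorem IsDSequence.smul [Module ℝ Z] [PosSMulMono ℝ Z] {a : ℕ → ℕ → Z} (ha : IsDSequence a)
    {r : ℝ} (hr : 0 < r) : IsDSequence fun i j => r • a i j where
  bddAbove := by
    obtain ⟨M, hM⟩ := ha.bddAbove
    exact ⟨r • M, by
      rintro _ ⟨p, rfl⟩; exact smul_le_smul_of_nonneg_left (hM ⟨p, rfl⟩) hr.le⟩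
  antitone i _ _ h := smul_le_smul_of_nonneg_left (ha.antitone i h) hr.le
  isGLB i := by
    refine ⟨?_, fun c hc => ?_⟩
    · rintro _ ⟨j, rfl⟩
      exact smul_nonneg hr.le (ha.nonneg i j)
    · have h : r⁻¹ • c ≤ 0 := (ha.isGLB i).2 <| by
        rintro _ ⟨j, rfl⟩
        simpa [smul_smul, hr.ne'] using
          smul_le_smul_of_nonneg_left (hc ⟨j, rfl⟩) (inv_nonneg.2 hr.le)
      simpa [smul_smul, hr.ne'] using smul_le_smul_of_nonneg_left h hr.le

theorem IsDSequence.smul_iSup_le [Module ℝ Z] [PosSMulMono ℝ Z] {a : ℕ → ℕ → Z}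
    (ha : IsDSequence a) {r : ℝ} (hr : 0 < r) (φ : ℕ → ℕ) :
    r • (⨆ k, a k (φ k)) ≤ ⨆ k, r • a k (φ k) := by
  have h : ⨆ k, a k (φ k) ≤ r⁻¹ • ⨆ k, r • a k (φ k) := ciSup_le fun k => by
    simpa [smul_smul, hr.ne'] using smul_le_smul_of_nonneg_left
      (le_ciSup ((ha.smul hr).bddAbove_range φ) k) (inv_nonneg.2 hr.le)
  simpa [smul_smul, hr.ne'] using smul_le_smul_of_nonneg_left h hr.le

variable [IsOrderedAddMonoid Z]

/-- Infinite distributivity, from the splitting `x = x ⊓ u + (x ⊔ u - u)`: the second summand at `x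
i` is at most its value at the supremum. -/
theorem ciSup_inf_le {ι : Type*} [Nonempty ι] {x : ι → Z} (hx : BddAbove (range x)) {u y : Z}
    (h : ∀ i, x i ⊓ u ≤ y) : (⨆ i, x i) ⊓ u ≤ y := by
  have key : (⨆ i, x i) ≤ y + ((⨆ i, x i) ⊔ u - u) := by
    refine ciSup_le fun i => ?_
    have e : x i = x i ⊓ u + (x i ⊔ u - u) := by
      rw [← add_sub_assoc, inf_add_sup, add_sub_cancel_right]
    rw [e]
    exact add_le_add (h i) (sub_le_sub_right (sup_le_sup_right (le_ciSup hx i) _) _)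
  have e : (⨆ i, x i) ⊓ u = (⨆ i, x i) - ((⨆ i, x i) ⊔ u - u) := by
    rw [eq_sub_iff_add_eq, ← add_sub_assoc, inf_add_sup, add_sub_cancel_right]
  rw [e]
  exact sub_le_iff_le_add.2 key

/-- A single φ for the merged regulator controls all the `a n` at once, each along its own section
`i ↦ φ (Nat.pair n i)`; the price is the truncation at u. -/
theorem IsDSequence.le_merge {a : ℕ → ℕ → ℕ → Z} (ha : ∀ n, IsDSequence (a n)) {u : Z}
    (hu : 0 ≤ u) (φ : ℕ → ℕ) (n : ℕ) :
    (⨆ i, a n i (φ (Nat.pair n i))) ⊓ u ≤ ⨆ k, a k.unpair.1 k.unpair.2 (φ k) ⊓ u := by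
  refine ciSup_inf_le ((ha n).bddAbove_range fun i => φ (Nat.pair n i)) fun i => ?_
  simpa using le_ciSup ((isDSequence_merge ha hu).bddAbove_range φ) (Nat.pair n i)

end Regulators

/-! ### Limits of nets -/

section Nets

variable {Z : Type*} [AddCommGroup Z] [ConditionallyCompleteLattice Z]

theorem DConvergesTo.isGLB (hZ : WeaklySigmaDistributive Z) {b : ℕ → Z} (hb : DConvergesTo b 0)
    (hb₀ : ∀ n, 0 ≤ b n) : IsGLB (range b) 0 := by
  obtain ⟨a, ha, hba⟩ := hb
  refine ⟨by rintro _ ⟨n, rfl⟩; exact hb₀ n, fun c hc => (hZ a ha).2 ?_⟩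
  rintro _ ⟨φ, rfl⟩
  obtain ⟨n, hn⟩ := hba φ
  have h := hn n le_rfl
  rw [sub_zero] at h
  exact (hc ⟨n, rfl⟩).trans ((le_abs_self _).trans h)

variable [IsOrderedAddMonoid Z]

theorem le_add_of_abs_sub_le {x y c : Z} (h : |x - y| ≤ c) : x ≤ y + c :=
  sub_le_iff_le_add'.1 ((le_abs_self _).trans h)

theorem le_add_of_abs_sub_le' {x y c : Z} (h : |x - y| ≤ c) : y ≤ x + c :=
  le_add_of_abs_sub_le (abs_sub_comm x y ▸ h)

theorem abs_sub_le_of_le_add {x y c : Z} (h₁ : x ≤ y + c) (h₂ : y ≤ x + c) : |x - y| ≤ c :=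
  abs_le'.2 ⟨sub_le_iff_le_add'.2 h₁, by rw [neg_sub]; exact sub_le_iff_le_add'.2 h₂⟩

theorem abs_sub_le_add {x y z c d : Z} (h₁ : |x - y| ≤ c) (h₂ : |y - z| ≤ d) :
    |x - z| ≤ c + d := by
  rw [← sub_add_sub_cancel x y z]
  exact (abs_add_le _ _).trans (add_le_add h₁ h₂)

/-- The excess `l - (m + c)` is at most the sum of a supremum depending on φ and one depending on ψ;
weak σ-distributivity removes first the one, then the other. -/
theorem DConvergesTo.le_add (hZ : WeaklySigmaDistributive Z) {I : Type*} [Preorder I]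
    [IsDirectedOrder I] {x y : I → Z} {l m c : Z} (hx : DConvergesTo x l)
    (hy : DConvergesTo y m) (h : ∃ i₀, ∀ i, i₀ ≤ i → x i ≤ y i + c) : l ≤ m + c := by
  obtain ⟨a, ha, hxa⟩ := hx
  obtain ⟨b, hb, hyb⟩ := hy
  obtain ⟨i₀, hi₀⟩ := h
  have key : ∀ φ ψ : ℕ → ℕ, l - (m + c) - ⨆ k, b k (ψ k) ≤ ⨆ k, a k (φ k) := by
    intro φ ψ
    obtain ⟨i₁, hi₁⟩ := hxa φ
    obtain ⟨i₂, hi₂⟩ := hyb ψ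
    obtain ⟨j, hj₀, hj₁⟩ := exists_ge_ge i₀ i₁
    obtain ⟨i, hij, hi⟩ := exists_ge_ge j i₂
    rw [sub_le_iff_le_add, sub_le_iff_le_add]
    calc l ≤ x i + ⨆ k, a k (φ k) := le_add_of_abs_sub_le' (hi₁ i (hj₁.trans hij))
      _ ≤ (m + (⨆ k, b k (ψ k)) + c) + ⨆ k, a k (φ k) :=
        add_le_add_left ((hi₀ i (hj₀.trans hij)).trans
          (add_le_add_left (le_add_of_abs_sub_le (hi₂ i hi)) _)) _
      _ = _ := by abel
  have h₁ : ∀ ψ : ℕ → ℕ, l - (m + c) ≤ ⨆ k, b k (ψ k) := fun ψ =>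
    sub_nonpos.1 ((hZ a ha).2 (by rintro _ ⟨φ, rfl⟩; exact key φ ψ))
  exact sub_nonpos.1 ((hZ b hb).2 (by rintro _ ⟨ψ, rfl⟩; exact h₁ ψ))

theorem orderConvergesTo_of_abs_sub_le {s b : ℕ → Z} {t : Z} (hb : Antitone b)
    (hb₀ : IsGLB (range b) 0) (h : ∀ n, |s n - t| ≤ b n) : OrderConvergesTo s t := by
  refine ⟨range fun n => t - b n, range fun n => t + b n, range_nonempty _, range_nonempty _,
    ?_, ?_, ⟨?_, fun c hc => ?_⟩, ⟨?_, fun c hc => ?_⟩, ?_⟩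
  · exact directedOn_range.2 (Monotone.directed_le fun m n hmn => sub_le_sub_left (hb hmn) t)
  · exact directedOn_range.2 (Antitone.directed_ge fun m n hmn => add_le_add_right (hb hmn) t)
  · rintro _ ⟨n, rfl⟩
    exact sub_le_self _ (hb₀.1 ⟨n, rfl⟩)
  · refine sub_nonpos.1 (hb₀.2 ?_)
    rintro _ ⟨n, rfl⟩
    exact sub_le_comm.1 (hc ⟨n, rfl⟩)
  · rintro _ ⟨n, rfl⟩
    exact le_add_of_nonneg_right (hb₀.1 ⟨n, rfl⟩)
  · refine sub_nonpos.1 (hb₀.2 ?_)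
    rintro _ ⟨n, rfl⟩
    exact sub_le_iff_le_add'.2 (hc ⟨n, rfl⟩)
  · rintro _ ⟨m, rfl⟩ _ ⟨n, rfl⟩
    refine ⟨max m n, fun i hi => ⟨?_, ?_⟩⟩
    · exact sub_le_iff_le_add.2 ((le_add_of_abs_sub_le' (h i)).trans
        (add_le_add_right (hb ((le_max_left m n).trans hi)) _))
    · exact (le_add_of_abs_sub_le (h i)).trans
        (add_le_add_right (hb ((le_max_right m n).trans hi)) _)

/-- Every left end `s m - b m` lies below every right end `s n + b n`, so the supremum of the left
ends lies in all these intervals. -/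
theorem exists_abs_sub_le_of_cauchy {s b : ℕ → Z} (h : ∀ m n, s m ≤ s n + (b n + b m)) :
    ∃ t, ∀ n, |s n - t| ≤ b n := by
  have hle : ∀ m n, s m - b m ≤ s n + b n := fun m n =>
    sub_le_iff_le_add.2 ((h m n).trans_eq (add_assoc _ _ _).symm)
  have hbdd : BddAbove (range fun n => s n - b n) :=
    ⟨s 0 + b 0, by rintro _ ⟨m, rfl⟩; exact hle m 0⟩
  exact ⟨⨆ n, (s n - b n), fun n => abs_sub_le_of_le_add
    (sub_le_iff_le_add.1 (le_ciSup hbdd n)) (ciSup_le fun m => hle m n)⟩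

/-- A uniform limit of `(D)`-convergent nets is `(D)`-convergent. -/
theorem DConvergesTo.of_uniform_approx [Module ℝ Z] [PosSMulMono ℝ Z] {I : Type*} [Preorder I]
    [IsDirectedOrder I] {S : ℕ → I → Z} {s : ℕ → Z} {T : I → Z} {t : Z} {b : ℕ → Z}
    (hb : DConvergesTo b 0) (hb_anti : Antitone b) (hb₀ : ∀ n, 0 ≤ b n)
    (hS : ∀ n, DConvergesTo (S n) (s n))
    (hST : ∀ n, ∃ i₀, ∀ i, i₀ ≤ i → |S n i - T i| ≤ b n)
    (hst : ∀ n, |s n - t| ≤ b n) : DConvergesTo T t := by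
  obtain ⟨c, hc, hbc⟩ := hb
  choose a ha hSa using hS
  -- Slot 0 holds the regulator of `b`, slot `n + 1` that of `S n`.
  let e : ℕ → ℕ → ℕ → Z := fun n => Nat.casesOn n c a
  have he : ∀ n, IsDSequence (e n) := fun n => by cases n <;> [exact hc; exact ha _]
  -- A bound for `|S n i - s n|` independent of n, along the chain `S n i`, `T i`, `S 0 i`, `s 0`,
  -- `t`, `s n`: each link costs at most `b 0`, except the third, which costs `⨆ k, a 0 k 0`.
  let u : Z := (b 0 + b 0 + (⨆ k, a 0 k 0)) + (b 0 + b 0)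
  have hA : 0 ≤ ⨆ k, a 0 k 0 := (ha 0).iSup_nonneg fun _ => 0
  have hu : 0 ≤ u := by have := hb₀ 0; positivity
  have hbu : b 0 ≤ u :=
    le_add_of_nonneg_of_le (by have := hb₀ 0; positivity) (le_add_of_nonneg_left (hb₀ 0))
  -- The factor 3 pays for the steps from `T i` to `S n i`, to `s n`, to `t`. Given φ, slot 0
  -- selects n; only then is slot `n + 1` used to select the index.
  refine ⟨_, (isDSequence_merge he hu).smul (r := 3) (by norm_num), fun φ => ?_⟩
  set D := ⨆ k, e k.unpair.1 k.unpair.2 (φ k) ⊓ u with hD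
  obtain ⟨n, hn⟩ := hbc fun i => φ (Nat.pair 0 i)
  have hbD : b n ≤ D := by
    have h := hn n le_rfl
    rw [sub_zero] at h
    exact (le_inf ((le_abs_self _).trans h) ((hb_anti (Nat.zero_le n)).trans hbu)).trans
      (IsDSequence.le_merge he hu φ 0)
  obtain ⟨i₁, hi₁⟩ := hSa n fun i => φ (Nat.pair (n + 1) i)
  obtain ⟨i₂, hi₂⟩ := hSa 0 fun _ => 0
  obtain ⟨i₃, hi₃⟩ := hST n
  obtain ⟨i₄, hi₄⟩ := hST 0
  obtain ⟨j, hj₁, hj₂⟩ := exists_ge_ge i₁ i₂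
  obtain ⟨j', hj₃, hj₄⟩ := exists_ge_ge i₃ i₄
  obtain ⟨i₀, hj, hj'⟩ := exists_ge_ge j j'
  refine ⟨i₀, fun i hi => ?_⟩
  have h₁ := hi₁ i (hj₁.trans (hj.trans hi))
  have h₂ := hi₂ i (hj₂.trans (hj.trans hi))
  have h₃ := hi₃ i (hj₃.trans (hj'.trans hi))
  have h₄ := hi₄ i (hj₄.trans (hj'.trans hi))
  have hbn := hb_anti (Nat.zero_le n)
  have h₅ : |S n i - s n| ≤ u :=
    abs_sub_le_add (abs_sub_le_add (abs_sub_le_add (h₃.trans hbn) (abs_sub_comm (T i) _ ▸ h₄)) h₂)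
      (abs_sub_le_add (hst 0) (abs_sub_comm t _ ▸ (hst n).trans hbn))
  have h₆ : |S n i - s n| ≤ D := (le_inf h₁ h₅).trans (IsDSequence.le_merge he hu φ (n + 1))
  have h₇ : |T i - t| ≤ D + D + D :=
    abs_sub_le_add (abs_sub_le_add (abs_sub_comm (T i) _ ▸ h₃.trans hbD) h₆) ((hst n).trans hbD)
  refine h₇.trans (le_trans (le_of_eq ?_)
    ((isDSequence_merge he hu).smul_iSup_le (r := 3) (by norm_num) φ))
  rw [← hD, show (3 : ℝ) = 1 + 1 + 1 by norm_num, add_smul, add_smul, one_smul]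

/-- Monotonicity turns an eventual upper bound into a bound on the whole net; conversely, the range
of the net and `{l}` serve as lower and upper families. -/
theorem orderConvergesTo_iff_isLUB {I X : Type*} [Preorder I] [IsDirectedOrder I] [Nonempty I]
    [Preorder X] {x : I → X} (hx : Monotone x) {l : X} :
    OrderConvergesTo x l ↔ IsLUB (range x) l := by
  constructor
  · rintro ⟨L, U, ⟨a, ha⟩, ⟨b, hb⟩, -, -, hL, hU, h⟩
    refine ⟨?_, fun c hc => hL.2 fun a' ha' => ?_⟩
    · rintro _ ⟨i, rfl⟩
      refine hU.2 fun b' hb' => ?_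
      obtain ⟨i₀, hi₀⟩ := h a ha b' hb'
      obtain ⟨j, hij, hj⟩ := exists_ge_ge i i₀
      exact (hx hij).trans (hi₀ j hj).2
    · obtain ⟨i₀, hi₀⟩ := h a' ha' b hb
      exact (hi₀ i₀ le_rfl).1.trans (hc ⟨i₀, rfl⟩)
  · intro h
    refine ⟨range x, {l}, range_nonempty _, singleton_nonempty _,
      directedOn_range.2 hx.directed_le, directedOn_singleton _, h, isGLB_singleton, ?_⟩
    rintro _ ⟨i, rfl⟩ _ rfl
    exact ⟨i, fun j hij => ⟨hx hij, h.1 ⟨j, rfl⟩⟩⟩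

end Nets

/-! ### Partitions -/

namespace CountablePartition

variable {Ω : Type*} {H : Set (Set Ω)}

/-- The partition of `A` with the single block `A` (no block if `A` is empty). -/
def single {A : Set Ω} (hA : A ∈ H) : CountablePartition H A where
  parts := {α | α = A ∧ α.Nonempty}
  countable := (countable_singleton A).mono fun _ h => h.1
  mem _ h := h.1 ▸ hA
  nonempty _ h := h.2
  disjoint _ h _ h' hne := (hne (h.1.trans h'.1.symm)).elim
  sUnion_eq := by
    ext x
    simp only [mem_sUnion, mem_ofPred_eq]
    exact ⟨fun ⟨_, h, hx⟩ => h.1 ▸ hx, fun hx => ⟨A, ⟨rfl, x, hx⟩, hx⟩⟩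

/-- The union of partitions of two disjoint sets. -/
def union {A B C : Set Ω} (P : CountablePartition H A) (Q : CountablePartition H B)
    (hAB : Disjoint A B) (hC : A ∪ B = C) : CountablePartition H C where
  parts := P.parts ∪ Q.parts
  countable := P.countable.union Q.countable
  mem _ h := h.elim (P.mem _) (Q.mem _)
  nonempty _ h := h.elim (P.nonempty _) (Q.nonempty _)
  disjoint := by
    have key : ∀ α ∈ P.parts, ∀ β ∈ Q.parts, Disjoint α β := fun α hα β hβ =>
      hAB.mono (P.sUnion_eq ▸ subset_sUnion_of_mem hα) (Q.sUnion_eq ▸ subset_sUnion_of_mem hβ)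
    rintro α (hα | hα) β (hβ | hβ) hne
    · exact P.disjoint hα hβ hne
    · exact key α hα β hβ
    · exact (key β hβ α hα).symm
    · exact Q.disjoint hα hβ hne
  sUnion_eq := by rw [sUnion_union, P.sUnion_eq, Q.sUnion_eq, hC]

/-- The blocks of `P` inside `A`, if every block of `P` lies in `A` or is disjoint from it. -/
def restrict {A C : Set Ω} (P : CountablePartition H C) (hAC : A ⊆ C)
    (h : ∀ α ∈ P.parts, α ⊆ A ∨ Disjoint α A) : CountablePartition H A where
  parts := {α ∈ P.parts | α ⊆ A}
  countable := P.countable.mono fun _ h => h.1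
  mem _ h := P.mem _ h.1
  nonempty _ h := P.nonempty _ h.1
  disjoint := P.disjoint.subset fun _ h => h.1
  sUnion_eq := by
    refine subset_antisymm (sUnion_subset fun α h => h.2) fun x hx => ?_
    obtain ⟨α, hα, hxα⟩ := P.sUnion_eq.symm ▸ hAC hx
    exact ⟨α, ⟨hα, (h α hα).resolve_right fun hd => hd.le_bot ⟨hxα, hx⟩⟩, hxα⟩

theorem subset_or_subset_of_union_single_le {A B C : Set Ω} (hA : A ∈ H) (hB : B ∈ H)
    (hAB : Disjoint A B) (hC : A ∪ B = C) {P : CountablePartition H C}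
    (hP : (single hA).union (single hB) hAB hC ≤ P) {α : Set Ω} (hα : α ∈ P.parts) :
    α ⊆ A ∨ α ⊆ B := by
  obtain ⟨β, hβ | hβ, hαβ⟩ := hP α hα
  · exact Or.inl (hαβ.trans hβ.1.subset)
  · exact Or.inr (hαβ.trans hβ.1.subset)

end CountablePartition

/-! ### Monotonicity of μ on blocks of partitions -/

section Measure

variable {Ω Y : Type*} [AddCommGroup Y] [Lattice Y] [Module ℝ Y]
  {η : NetConvergence Y} {H : Set (Set Ω)} {μ : Set Ω → Y}

theorem IsBoccutoCandeloro.le_of_monotone (hη : IsBoccutoCandeloro η) {I : Type} [Preorder I]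
    [IsDirectedOrder I] [Nonempty I] {x : I → Y} {a : Y} (hx : Monotone x) (h : η I x a)
    (i : I) : x i ≤ a :=
  hη.le I (fun _ => x i) x (x i) a (hη.const I _) h fun j =>
    let ⟨k, hik, hjk⟩ := exists_ge_ge i j
    ⟨k, hjk, hx hik⟩

variable [IsOrderedAddMonoid Y]

/-- The blocks are enumerated as a disjoint sequence padded with empty sets; the finite sums of μ
along it increase, so they stay below their limit `μ A`. -/
theorem IsSigmaAdditive.sum_parts_le (hη : IsBoccutoCandeloro η) (hH_empty : ∅ ∈ H)
    (hμ_nonneg : ∀ A ∈ H, 0 ≤ μ A) (hμ : IsSigmaAdditive η H μ) {A : Set Ω} (hA : A ∈ H)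
    (P : CountablePartition H A) {J : Finset (Set Ω)} (hJ : ↑J ⊆ P.parts) :
    ∑ α ∈ J, μ α ≤ μ A := by
  classical
  let _ := P.countable.toEncodable
  let F : ℕ → Set Ω := fun n => ⋃ b ∈ Encodable.decode₂ P.parts n, b.1
  have hF : ∀ n, F n ∈ H := fun n => Encodable.iUnion_decode₂_cases (C := (· ∈ H)) hH_empty
    fun b : P.parts => P.mem b.1 b.2
  have hU : ⋃ n, F n = A := by
    rw [Encodable.iUnion_decode₂, ← sUnion_eq_iUnion, P.sUnion_eq]
  have hF_encode : ∀ b : P.parts, F (Encodable.encode b) = b.1 := fun b => by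
    simp only [F, Encodable.decode₂_encode, Option.mem_some_iff, iUnion_iUnion_eq_right]
  have hdisj : Pairwise fun m n => Disjoint (F m) (F n) :=
    Encodable.iUnion_decode₂_disjoint_on fun b c hbc =>
      P.disjoint b.2 c.2 fun h => hbc (Subtype.ext h)
  have h := hμ F hF hdisj (hU.symm ▸ hA)
  rw [hU] at h
  have hmono : Monotone fun K : Finset ℕ => ∑ n ∈ K, μ (F n) := fun K K' hK =>
    Finset.sum_le_sum_of_subset_of_nonneg hK fun n _ _ => hμ_nonneg _ (hF n)
  refine le_trans (le_of_eq ?_) (hη.le_of_monotone hmono h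
    ((J.subtype (· ∈ P.parts)).image Encodable.encode))
  rw [Finset.sum_image Encodable.encode_injective.injOn]
  simp only [hF_encode]
  rw [Finset.sum_subtype_of_mem μ hJ]

/-- As `N \ α` need not belong to `H`, smallness of `μ α` comes from the blocks inside N, which form
a partition of N containing α. -/
theorem IsSigmaAdditive.eq_zero_of_subset_null (hη : IsBoccutoCandeloro η) (hH_empty : ∅ ∈ H)
    (hμ_nonneg : ∀ A ∈ H, 0 ≤ μ A) (hμ : IsSigmaAdditive η H μ) {N C : Set Ω} (hN : N ∈ H)
    (hN_null : μ N = 0) (hNC : N ⊆ C) (P : CountablePartition H C)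
    (hP : ∀ α ∈ P.parts, α ⊆ N ∨ Disjoint α N) {α : Set Ω} (hα : α ∈ P.parts) (hαN : α ⊆ N) :
    μ α = 0 := by
  refine le_antisymm ?_ (hμ_nonneg α (P.mem α hα))
  have h := hμ.sum_parts_le hη hH_empty hμ_nonneg hN (P.restrict hNC hP) (J := {α})
    (by simpa using ⟨hα, hαN⟩)
  rwa [Finset.sum_singleton, hN_null] at h

end Measure

/-! ### Riemann series -/

section Series

variable {Ω X Y Z : Type*} [AddCommGroup X] [Module ℝ X] [AddCommGroup Y] [Module ℝ Y]
  [AddCommGroup Z] [Module ℝ Z]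

open Classical in
/-- The term `f(δ_α) μ(α)` of a Riemann series. -/
noncomputable def riemannTerm (B : X →ₗ[ℝ] Y →ₗ[ℝ] Z) (f : Ω → X) (μ : Set Ω → Y)
    (δ : {α : Set Ω // α.Nonempty} → Ω) (α : Set Ω) : Z :=
  -- The value at the empty set is a dummy, since blocks are nonempty.
  if h : α.Nonempty then B (f (δ ⟨α, h⟩)) (μ α) else 0

variable {B : X →ₗ[ℝ] Y →ₗ[ℝ] Z} {f g : Ω → X} {μ : Set Ω → Y}
  {δ : {α : Set Ω // α.Nonempty} → Ω} {H : Set (Set Ω)} {A : Set Ω}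

theorem riemannTerm_of_nonempty {α : Set Ω} (h : α.Nonempty) :
    riemannTerm B f μ δ α = B (f (δ ⟨α, h⟩)) (μ α) := dif_pos h

theorem riemannTerm_eq_zero {α : Set Ω} (h : μ α = 0) : riemannTerm B f μ δ α = 0 := by
  unfold riemannTerm
  split_ifs <;> simp [h]

theorem partialRiemannSum_eq (P : CountablePartition H A) (J : Finset P.parts) :
    partialRiemannSum B f μ δ P J
      = ∑ α ∈ J.map (Function.Embedding.subtype _), riemannTerm B f μ δ α := by
  rw [Finset.sum_map]
  exact Finset.sum_congr rfl fun α _ => (riemannTerm_of_nonempty (P.nonempty α.1 α.2)).symm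

/-- Partial sums over different partitions have different index types; as sums over finite sets of
subsets of Ω they become comparable. -/
theorem range_partialRiemannSum (P : CountablePartition H A) :
    range (partialRiemannSum B f μ δ P)
      = (fun J : Finset (Set Ω) => ∑ α ∈ J, riemannTerm B f μ δ α) '' {J | ↑J ⊆ P.parts} := by
  classical
  ext z
  constructor
  · rintro ⟨J, rfl⟩
    refine ⟨_, ?_, (partialRiemannSum_eq P J).symm⟩
    intro α hα
    obtain ⟨b, -, rfl⟩ := Finset.mem_map.1 hα
    exact b.2
  · rintro ⟨J, hJ, rfl⟩
    refine ⟨J.subtype (· ∈ P.parts), ?_⟩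
    rw [partialRiemannSum_eq, Finset.subtype_map_of_mem hJ]

theorem range_partialRiemannSum_union {N C : Set Ω} (P : CountablePartition H A)
    (Q : CountablePartition H N) (h : Disjoint A N) (hC : A ∪ N = C)
    (hQ : ∀ α ∈ Q.parts, μ α = 0) :
    range (partialRiemannSum B f μ δ (P.union Q h hC)) = range (partialRiemannSum B f μ δ P) := by
  classical
  rw [range_partialRiemannSum, range_partialRiemannSum]
  apply subset_antisymm
  · rintro _ ⟨J, hJ, rfl⟩
    refine ⟨J.filter (· ∈ P.parts), fun α hα => (Finset.mem_filter.1 hα).2, ?_⟩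
    refine Finset.sum_filter_of_ne fun α hα hne => ?_
    exact (hJ hα).resolve_right fun hαQ => hne (riemannTerm_eq_zero (hQ α hαQ))
  · exact image_mono fun J hJ => subset_union_of_subset_left hJ _

end Series

/-! ### Comparison of Riemann series, and null sets -/

section Integral

variable {Ω X Y Z : Type*} [AddCommGroup X] [Lattice X] [Module ℝ X]
  [AddCommGroup Y] [Lattice Y] [Module ℝ Y]
  [AddCommGroup Z] [ConditionallyCompleteLattice Z] [Module ℝ Z]
  {η₁ : NetConvergence X} {η₂ : NetConvergence Y} {η₃ : NetConvergence Z}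
  {B : X →ₗ[ℝ] Y →ₗ[ℝ] Z} {f g : Ω → X} {μ : Set Ω → Y}
  {δ : {α : Set Ω // α.Nonempty} → Ω} {H : Set (Set Ω)} {A : Set Ω}

theorem IsRieszProduct.nonneg (hB : IsRieszProduct η₁ η₂ η₃ B) {x : X} {y : Y} (hx : 0 ≤ x)
    (hy : 0 ≤ y) : 0 ≤ B x y := by
  simpa using hB.isotone 0 x 0 y le_rfl hx le_rfl hy

variable [IsOrderedAddMonoid Z]

theorem hasRiemannSeries_iff_isLUB (hB : IsRieszProduct η₁ η₂ η₃ B)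
    (hμ_nonneg : ∀ A ∈ H, 0 ≤ μ A) (hf : ∀ ω, 0 ≤ f ω) {P : CountablePartition H A} {t : Z} :
    HasRiemannSeries B f μ δ P t ↔ IsLUB (range (partialRiemannSum B f μ δ P)) t :=
  orderConvergesTo_iff_isLUB (x := partialRiemannSum B f μ δ P) fun _ _ h =>
    Finset.sum_le_sum_of_subset_of_nonneg h
      fun α _ _ => hB.nonneg (hf _) (hμ_nonneg _ (P.mem _ α.2))

variable [IsOrderedAddMonoid Y]

theorem sum_riemannTerm_le_add (hB : IsRieszProduct η₁ η₂ η₃ B) (hη₂ : IsBoccutoCandeloro η₂)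
    (hH_empty : ∅ ∈ H) (hμ_nonneg : ∀ A ∈ H, 0 ≤ μ A) (hμ : IsSigmaAdditive η₂ H μ)
    (hA : A ∈ H) (hδ : IsChoiceFunction δ) (hf : ∀ ω, 0 ≤ f ω) {u : X} (hu : 0 ≤ u)
    {P : CountablePartition H A}
    (hfg : ∀ α ∈ P.parts, μ α = 0 ∨ ∀ ω ∈ α, f ω ≤ g ω + u) {J : Finset (Set Ω)}
    (hJ : ↑J ⊆ P.parts) :
    ∑ α ∈ J, riemannTerm B f μ δ α ≤ ∑ α ∈ J, riemannTerm B g μ δ α + B u (μ A) := by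
  calc ∑ α ∈ J, riemannTerm B f μ δ α
      ≤ ∑ α ∈ J, (riemannTerm B g μ δ α + B u (μ α)) := by
        refine Finset.sum_le_sum fun α hα => ?_
        rcases hfg α (hJ hα) with h | h
        · simp [riemannTerm_eq_zero h, h]
        · rw [riemannTerm_of_nonempty (P.nonempty α (hJ hα)),
            riemannTerm_of_nonempty (P.nonempty α (hJ hα)), ← LinearMap.add_apply, ← map_add]
          exact hB.isotone _ _ _ _ (hf _) (h _ (hδ ⟨α, _⟩)) (hμ_nonneg _ (P.mem α (hJ hα))) le_rfl
    _ = ∑ α ∈ J, riemannTerm B g μ δ α + B u (∑ α ∈ J, μ α) := by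
        rw [Finset.sum_add_distrib, map_sum]
    _ ≤ _ := add_le_add_right (hB.isotone _ _ _ _ hu le_rfl
        (Finset.sum_nonneg fun α hα => hμ_nonneg _ (P.mem α (hJ hα)))
        (hμ.sum_parts_le hη₂ hH_empty hμ_nonneg hA P hJ)) _

/-- Applied in both directions between `f n` and its limit: it bounds the difference of the series,
and it supplies the bound from which the limit's series exists. -/
theorem upperBound_partialRiemannSum (hB : IsRieszProduct η₁ η₂ η₃ B)
    (hη₂ : IsBoccutoCandeloro η₂) (hH_empty : ∅ ∈ H) (hμ_nonneg : ∀ A ∈ H, 0 ≤ μ A)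
    (hμ : IsSigmaAdditive η₂ H μ) (hA : A ∈ H) (hδ : IsChoiceFunction δ) (hf : ∀ ω, 0 ≤ f ω)
    {u : X} (hu : 0 ≤ u) {P : CountablePartition H A}
    (hfg : ∀ α ∈ P.parts, μ α = 0 ∨ ∀ ω ∈ α, f ω ≤ g ω + u) {t : Z}
    (ht : IsLUB (range (partialRiemannSum B g μ δ P)) t) :
    t + B u (μ A) ∈ upperBounds (range (partialRiemannSum B f μ δ P)) := by
  rw [range_partialRiemannSum] at ht ⊢
  rintro _ ⟨J, hJ, rfl⟩
  exact (sum_riemannTerm_le_add hB hη₂ hH_empty hμ_nonneg hμ hA hδ hf hu hfg hJ).trans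
    (add_le_add_left (ht.1 ⟨J, hJ, rfl⟩) _)

theorem exists_isChoiceFunction (Ω : Type*) :
    ∃ δ : {α : Set Ω // α.Nonempty} → Ω, IsChoiceFunction δ :=
  ⟨fun α => α.2.some, fun α => α.2.some_mem⟩

/-- The integral is not affected by the removal of a null set. -/
theorem HasSStarIntegral.diff_null (hη₂ : IsBoccutoCandeloro η₂)
    (hB : IsRieszProduct η₁ η₂ η₃ B) (hH_empty : ∅ ∈ H)
    [IsDirectedOrder (CountablePartition H (univ : Set Ω))]
    (hμ_nonneg : ∀ A ∈ H, 0 ≤ μ A) (hμ : IsSigmaAdditive η₂ H μ) {N : Set Ω} (hN : N ∈ H)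
    (hN_compl : univ \ N ∈ H) (hN_null : μ N = 0) (hf : ∀ ω, 0 ≤ f ω) {s : Z}
    (h : HasSStarIntegral B H f μ univ s) : HasSStarIntegral B H f μ (univ \ N) s := by
  intro δ hδ
  obtain ⟨S, ⟨P₀, hP₀⟩, a, ha, hSa⟩ := h δ hδ
  have hd : Disjoint (univ \ N) N := disjoint_sdiff_left
  have hU : (univ \ N) ∪ N = univ := sdiff_union_of_subset (subset_univ N)
  let R := (CountablePartition.single hN_compl).union (CountablePartition.single hN) hd hU
  have hR : ∀ P, R ≤ P → ∀ α ∈ P.parts, α ⊆ univ \ N ∨ α ⊆ N := fun P hP α hα =>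
    CountablePartition.subset_or_subset_of_union_single_le hN_compl hN hd hU hP hα
  let S' : CountablePartition H (univ \ N) → Z := fun Q => ⨆ J, partialRiemannSum B f μ δ Q J
  -- If Q refines the trace of P on the complement of N, adjoining the blocks of P inside N gives a
  -- refinement P' of P. The adjoined blocks are null, so Q and P' have the same series, and the
  -- regulator for `univ` can be kept.
  have key : ∀ P, P₀ ≤ P → R ≤ P → ∃ Q₀ : CountablePartition H (univ \ N), ∀ Q, Q₀ ≤ Q →
      ∃ P', P ≤ P' ∧ IsLUB (range (partialRiemannSum B f μ δ Q)) (S P') ∧ S' Q = S P' := by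
    intro P hP hRP
    have hE : ∀ α ∈ P.parts, α ⊆ univ \ N ∨ Disjoint α (univ \ N) := fun α hα =>
      (hR P hRP α hα).imp_right fun h => hd.symm.mono_left h
    have hN' : ∀ α ∈ P.parts, α ⊆ N ∨ Disjoint α N := fun α hα =>
      (hR P hRP α hα).symm.imp_right fun h => hd.mono_left h
    refine ⟨P.restrict (subset_univ _) hE, fun Q hQ => ?_⟩
    let K := P.restrict (subset_univ _) hN'
    have hle : P ≤ Q.union K hd hU := by
      rintro β (hβ | hβ)
      · obtain ⟨α, hα, hβα⟩ := hQ β hβ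
        exact ⟨α, hα.1, hβα⟩
      · exact ⟨β, hβ.1, subset_rfl⟩
    have hK : ∀ α ∈ K.parts, μ α = 0 := fun α hα => hμ.eq_zero_of_subset_null hη₂ hH_empty
      hμ_nonneg hN hN_null (subset_univ _) P hN' hα.1 hα.2
    have hlub := (hasRiemannSeries_iff_isLUB hB hμ_nonneg hf).1 (hP₀ _ (le_trans hP hle))
    rw [range_partialRiemannSum_union Q K hd hU hK] at hlub
    exact ⟨_, hle, hlub, hlub.csSup_eq (range_nonempty _)⟩
  obtain ⟨P₁, hP₁, hRP₁⟩ := exists_ge_ge P₀ R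
  refine ⟨S', ?_, a, ha, fun φ => ?_⟩
  · obtain ⟨Q₀, hQ₀⟩ := key P₁ hP₁ hRP₁
    refine ⟨Q₀, fun Q hQ => (hasRiemannSeries_iff_isLUB hB hμ_nonneg hf).2 ?_⟩
    obtain ⟨P', -, hlub, heq⟩ := hQ₀ Q hQ
    exact heq ▸ hlub
  · obtain ⟨P₂, hP₂⟩ := hSa φ
    obtain ⟨P, hP₁P, hP₂P⟩ := exists_ge_ge P₁ P₂
    obtain ⟨Q₀, hQ₀⟩ := key P (le_trans hP₁ hP₁P) (le_trans hRP₁ hP₁P)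
    refine ⟨Q₀, fun Q hQ => ?_⟩
    obtain ⟨P', hPP', -, heq⟩ := hQ₀ Q hQ
    rw [heq]
    exact hP₂ P' (le_trans hP₂P hPP')

end Integral

/-! ### Integration of order uniform limits -/

theorem mainTheorem2 {Ω X Y Z : Type*}
    [AddCommGroup X] [Lattice X] [IsOrderedAddMonoid X] [Module ℝ X] [PosSMulMono ℝ X]
    [AddCommGroup Y] [Lattice Y] [IsOrderedAddMonoid Y] [Module ℝ Y] [PosSMulMono ℝ Y]
    [AddCommGroup Z] [ConditionallyCompleteLattice Z] [IsOrderedAddMonoid Z] [Module ℝ Z]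
    [PosSMulMono ℝ Z]
    (hZ : WeaklySigmaDistributive Z)
    (η₁ : NetConvergence X) (hη₁ : IsBoccutoCandeloro η₁)
    (hη₁_mono : HasSeqMonotoneConvergence η₁)
    (η₂ : NetConvergence Y) (hη₂ : IsBoccutoCandeloro η₂)
    (B : X →ₗ[ℝ] Y →ₗ[ℝ] Z) (hB : IsRieszProduct η₁ η₂ (dNetConvergence Z) B)
    (H : Set (Set Ω)) (hH_empty : ∅ ∈ H) (hH_univ : Set.univ ∈ H)
    (hH_directed : ∀ A ∈ H, IsDirectedOrder (CountablePartition H A))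
    (μ : Set Ω → Y) (hμ_nonneg : ∀ A ∈ H, 0 ≤ μ A) (hμ : IsSigmaAdditive η₂ H μ)
    (N : Set Ω) (hN : N ∈ H) (hN_compl : Set.univ \ N ∈ H) (hN_null : μ N = 0)
    (f : ℕ → Ω → X) (hf_nonneg : ∀ n ω, 0 ≤ f n ω)
    (g : Ω → X) (hg_nonneg : ∀ ω, 0 ≤ g ω)
    (hfg : OrderUniformlyConvergesOn f g (Set.univ \ N))
    (s : ℕ → Z) (hf : ∀ n, HasSStarIntegral B H (f n) μ Set.univ (s n)) :
    ∃ t : Z, HasSStarIntegral B H g μ (Set.univ \ N) t ∧ HasSStarIntegral B H g μ Set.univ t ∧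
      OrderConvergesTo s t := by
  obtain ⟨u, hu_anti, hu_glb, hfg⟩ := hfg
  have hu : ∀ n, 0 ≤ u n := fun n => hu_glb.1 ⟨n, rfl⟩
  have hΩ : 0 ≤ μ univ := hμ_nonneg _ hH_univ
  have := hH_directed univ hH_univ
  let b : ℕ → Z := fun n => B (u n) (μ univ)
  have hb_anti : Antitone b := fun m n h => hB.isotone _ _ _ _ (hu n) (hu_anti h) hΩ le_rfl
  have hb₀ : ∀ n, 0 ≤ b n := fun n => hB.nonneg (hu n) hΩ
  have hb : DConvergesTo b 0 := by
    have h : DConvergesTo b (B 0 (μ univ)) :=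
      hB.continuous_left (μ univ) ℕ u 0 (hη₁_mono u hu_anti hu_glb)
    simpa using h
  have hd : Disjoint (univ \ N) N := disjoint_sdiff_left
  have hU : (univ \ N) ∪ N = univ := sdiff_union_of_subset (subset_univ N)
  let R := (CountablePartition.single hN_compl).union (CountablePartition.single hN) hd hU
  have hR : ∀ P, R ≤ P → ∀ n, ∀ α ∈ P.parts,
      μ α = 0 ∨ ∀ ω ∈ α, f n ω ≤ g ω + u n ∧ g ω ≤ f n ω + u n := by
    intro P hP n α hα
    have h := fun β hβ => CountablePartition.subset_or_subset_of_union_single_le hN_compl hN hd hU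
      hP (α := β) hβ
    rcases h α hα with h' | h'
    · refine Or.inr fun ω hω => ?_
      have hω' := abs_le'.1 (hfg n ω (h' hω))
      rw [neg_sub] at hω'
      exact ⟨sub_le_iff_le_add'.1 hω'.1, sub_le_iff_le_add'.1 hω'.2⟩
    · exact Or.inl (hμ.eq_zero_of_subset_null hη₂ hH_empty hμ_nonneg hN hN_null (subset_univ _) P
        (fun β hβ => (h β hβ).symm.imp_right fun h => hd.mono_left h) hα h')
  have series : ∀ δ : {α : Set Ω // α.Nonempty} → Ω, IsChoiceFunction δ →
      ∃ (S : ℕ → CountablePartition H (univ : Set Ω) → Z)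
        (T : CountablePartition H (univ : Set Ω) → Z),
        (∀ n, DConvergesTo (S n) (s n)) ∧ (∃ P₀, ∀ P, P₀ ≤ P → HasRiemannSeries B g μ δ P (T P)) ∧
        ∀ n, ∃ P₀, ∀ P, P₀ ≤ P → |S n P - T P| ≤ b n := by
    intro δ hδ
    choose S hS hSs using fun n => hf n δ hδ
    choose P₀ hP₀ using hS
    have hlub : ∀ n P, P₀ n ≤ P → IsLUB (range (partialRiemannSum B (f n) μ δ P)) (S n P) :=
      fun n P hP => (hasRiemannSeries_iff_isLUB hB hμ_nonneg (hf_nonneg n)).1 (hP₀ n P hP)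
    have hup : ∀ n P, P₀ n ≤ P → R ≤ P →
        S n P + b n ∈ upperBounds (range (partialRiemannSum B g μ δ P)) := fun n P hP hRP =>
      upperBound_partialRiemannSum hB hη₂ hH_empty hμ_nonneg hμ hH_univ hδ hg_nonneg (hu n)
        (fun α hα => (hR P hRP n α hα).imp_right fun h ω hω => (h ω hω).2) (hlub n P hP)
    -- Dedekind completeness gives the supremum; comparison with any single `f n` provides
    -- boundedness.
    have hT : ∀ n P, P₀ n ≤ P → R ≤ P → IsLUB (range (partialRiemannSum B g μ δ P))
        (⨆ J, partialRiemannSum B g μ δ P J) := fun n P hP hRP =>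
      isLUB_ciSup ⟨_, hup n P hP hRP⟩
    refine ⟨S, fun P => ⨆ J, partialRiemannSum B g μ δ P J, hSs, ?_, fun n => ?_⟩
    · obtain ⟨P₁, h₁, h₂⟩ := exists_ge_ge (P₀ 0) R
      exact ⟨P₁, fun P hP => (hasRiemannSeries_iff_isLUB hB hμ_nonneg hg_nonneg).2
        (hT 0 P (le_trans h₁ hP) (le_trans h₂ hP))⟩
    · obtain ⟨P₁, h₁, h₂⟩ := exists_ge_ge (P₀ n) R
      refine ⟨P₁, fun P hP => ?_⟩
      have hP' := le_trans h₁ hP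
      have hRP := le_trans h₂ hP
      refine abs_sub_le_of_le_add ((hlub n P hP').2 ?_) ((hT n P hP' hRP).2 (hup n P hP' hRP))
      exact upperBound_partialRiemannSum hB hη₂ hH_empty hμ_nonneg hμ hH_univ hδ (hf_nonneg n)
        (hu n) (fun α hα => (hR P hRP n α hα).imp_right fun h ω hω => (h ω hω).1)
        (hT n P hP' hRP)
  -- The integrals `s n` do not depend on δ, so one choice function suffices here, and the resulting
  -- `t` serves for all of them.
  have hcauchy : ∀ m n, s m ≤ s n + (b n + b m) := by
    intro m n
    obtain ⟨δ, hδ⟩ := exists_isChoiceFunction Ω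
    obtain ⟨S, T, hS, -, hST⟩ := series δ hδ
    refine (hS m).le_add hZ (hS n) ?_
    obtain ⟨P₁, h₁⟩ := hST m
    obtain ⟨P₂, h₂⟩ := hST n
    obtain ⟨P₀, h₁₀, h₂₀⟩ := exists_ge_ge P₁ P₂
    refine ⟨P₀, fun P hP => ?_⟩
    rw [add_comm (b n)]
    exact le_add_of_abs_sub_le (abs_sub_le_add (h₁ P (le_trans h₁₀ hP))
      (abs_sub_comm (S n P) _ ▸ h₂ P (le_trans h₂₀ hP)))
  obtain ⟨t, ht⟩ := exists_abs_sub_le_of_cauchy hcauchy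
  have hg : HasSStarIntegral B H g μ univ t := by
    intro δ hδ
    obtain ⟨S, T, hS, hT, hST⟩ := series δ hδ
    exact ⟨T, hT, hb.of_uniform_approx hb_anti hb₀ hS hST ht⟩
  exact ⟨t, hg.diff_null hη₂ hB hH_empty hμ_nonneg hμ hN hN_compl hN_null hg_nonneg, hg,
    orderConvergesTo_of_abs_sub_le hb_anti (hb.isGLB hZ hb₀) ht⟩
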